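/- **The protocol.** There are $n$ users, user $i$ holding $x_i\in[B]=\{1,\dots,B\}$. Let $0<\varepsilon\le 3$, $0<\delta<1$, let $q\in[B,2B)$ be a prime and $b\ge 2$ an integer. For $(u,v)\in[q-1]\times[q]$ put $h_{u,v}(x)=((ux+v)\bmod q)\bmod b$, and let $$\rho=\frac{32\ln(2/\delta)}{\varepsilon^2}\cdot\frac bn,\qquad p_{\rm col}=\frac{\lfloor q/b\rfloor\,[(q\bmod b)+q-b]}{q(q-1)}.$$ In $\mathcal P^{\rm FE1}$ each user, independently, chooses $(u,v)\in[q-1]\times[q]$ uniformly and sends $(u,v,h_{u,v}(x_i))$, and in addition sends $\lfloor\rho\rfloor$ independent uniform elements of $[q-1]\times[q]\times\{0,\dots,b-1\}$, and one more with probability $\rho-\lfloor\rho\rfloor$. The analyzer sees only the multiset sum $\mathcal T$ of all messages, and estimates the frequency of each $x\in[B]$ by $\hat g(x)=(X-n\rho/b-np_{\rm col})/(1-p_{\rm col})$, where $X$ is the number of $(u,v,w)\in\mathcal T$ (with multiplicity) such that $h_{u,v}(x)=w$. **Corollary.** For every $n$ let parameters $B,q,b,\varepsilon,\delta$ as above be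 given (all may depend on $n$), with $\delta$ bounded away from $1$ for large $n$, and with $B=\Omega\!\left(\frac{\varepsilon^2n}{\log(1/\delta)}\right)$ as $n\to\infty$. Let $f$ satisfy $f(n)=o(1)$ and $f(n)\ge(\log n)^{-c}$ for some constant $c>0$ and all large $n$, and suppose that, for all large $n$, $b$ is $f(n)\cdot\frac{\varepsilon^2n}{\log(1/\delta)}$ rounded to an integer (up or down). Then: 1. $\mathcal P^{\rm FE1}$ is $(\varepsilon,\delta)$-differentially private in the shuffle model: for all datasets $D,D'$ that differ in the entry of one user and every set $Y$ of multisets of messages, $\Pr[\mathcal T(D)\in Y]\le e^{\varepsilon}\Pr[\mathcal T(D')\in Y]+\delta$. 2. Each user sends $1+o(1)$ messages in expectation as $n\to\infty$. 3. The error is $\tilde O(1)$: there are constants $C,k$ such that for all large $n$, all $\beta\in(0,1]$ and every dataset, $$\Pr\left[\max_{x\in[B]}\bigl|\hat g(x)-\#\{i:x_i=x\}\bigr|>\frac C\varepsilon\Bigl(\log n+\log B+\log\tfrac1\delta+\log\tfrac1\beta\Bigr)^k\right]<\beta .$$ -/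

import Mathlib

open Filter Asymptotics Topology
open scoped ENNReal

/-! ### Randomized mechanisms, differential privacy, the shuffle model -/

/-- The domain `[B] = {1, …, B}`. -/
abbrev Dom (B : ℕ) : Type := ↥(Finset.Icc 1 B)

/-- The number of users holding the element `j`. -/
def freq {n B : ℕ} (D : Fin n → Dom B) (j : Dom B) : ℕ :=
  (Finset.univ.filter fun i => D i = j).card

/-- Two datasets are neighbouring if they agree except possibly in the entry of one user. -/
def Neighbouring {n : ℕ} {X : Type} (D D' : Fin n → X) : Prop :=
  ∃ i, ∀ j, j ≠ i → D j = D' j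

/-- `(ε, δ)`-differential privacy of a mechanism with `n` users. -/
def IsDifferentiallyPrivate {n : ℕ} {X Y : Type} (M : (Fin n → X) → PMF Y) (ε δ : ℝ) : Prop :=
  ∀ D D' : Fin n → X, Neighbouring D D' → ∀ S : Set Y,
    (M D).toOuterMeasure S ≤
      ENNReal.ofReal (Real.exp ε) * (M D').toOuterMeasure S + ENNReal.ofReal δ

/-- `(α, β)`-accuracy of a frequency estimation protocol: for every dataset, the maximal error over
the elements of `[B]` exceeds `α` with probability less than `β`. -/
def IsAccurate {n B : ℕ} (Q : (Fin n → Dom B) → PMF (Dom B → ℝ)) (α β : ℝ) : Prop :=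
  ∀ D : Fin n → Dom B,
    (Q D).toOuterMeasure {g | ∃ j, α < |g j - (freq D j : ℝ)|} < ENNReal.ofReal β

/-- The view of the analyzer in the multi-message shuffle model: the multiset sum of the outputs of
the users, who run the local randomizer `R` independently on their inputs. -/
noncomputable def shuffleView {X M : Type} (R : X → PMF (Multiset M)) :
    {n : ℕ} → (Fin n → X) → PMF (Multiset M)
  | 0, _ => PMF.pure 0
  | _ + 1, D =>
      (R (D 0)).bind fun S => (shuffleView R (Fin.tail D)).bind fun T => PMF.pure (S + T)

/-- The expected number of messages in a random multiset of messages. -/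
noncomputable def expectedCard {M : Type} (p : PMF (Multiset M)) : ℝ≥0∞ :=
  ∑' T, p T * (Multiset.card T : ℝ≥0∞)

/-- The multiset of `k` independent samples of `p`. -/
noncomputable def iidMultiset {M : Type} (p : PMF M) : ℕ → PMF (Multiset M)
  | 0 => PMF.pure 0
  | k + 1 => (iidMultiset p k).bind fun T => p.bind fun a => PMF.pure (a ::ₘ T)

/-! ### The protocol `FE1` -/

/-- Public parameters of the protocol for `n` users: the domain size `B`, a prime `q ∈ [B, 2B)`,
the number `b` of hash values, and the privacy parameters. -/
structure FE1 (n : ℕ) where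
  B : ℕ
  q : ℕ
  b : ℕ
  ε : ℝ
  δ : ℝ
  q_prime : q.Prime
  B_le_q : B ≤ q
  q_lt : q < 2 * B
  two_le_b : 2 ≤ b
  ε_pos : 0 < ε
  ε_le : ε ≤ 3
  δ_pos : 0 < δ
  δ_lt : δ < 1

namespace FE1

variable {n : ℕ} (P : FE1 n)

/-- A message `(u, v, w)`; the ones that occur lie in `[q-1] × [q] × ℤ_b`. -/
abbrev Message : Type := ℕ × ℕ × ℕ

/-- The hash function `h_{u,v}(x) = ((u x + v) mod q) mod b`. -/
def hash (u v x : ℕ) : ℕ := ((u * x + v) % P.q) % P.b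

/-- The common collision probability of two distinct elements of `[B]` under the hash family. -/
noncomputable def pcol : ℝ :=
  ((P.q / P.b : ℕ) : ℝ) * (((P.q % P.b : ℕ) : ℝ) + (P.q : ℝ) - (P.b : ℝ)) /
    ((P.q : ℝ) * ((P.q : ℝ) - 1))

/-- The expected number of blanket noises of each user. -/
noncomputable def rho : ℝ := 32 * Real.log (2 / P.δ) / P.ε ^ 2 * ((P.b : ℝ) / (n : ℝ))

/-- The seeds `[q-1] × [q]` of the hash family. -/
def seeds : Finset (ℕ × ℕ) := Finset.Icc 1 (P.q - 1) ×ˢ Finset.Icc 1 P.q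

/-- The message space `[q-1] × [q] × ℤ_b`. -/
def messages : Finset Message :=
  Finset.Icc 1 (P.q - 1) ×ˢ (Finset.Icc 1 P.q ×ˢ Finset.range P.b)

theorem seeds_nonempty : P.seeds.Nonempty := by
  have h := P.q_prime.two_le
  exact ⟨(1, 1), by simp only [seeds, Finset.mem_product, Finset.mem_Icc]; omega⟩

theorem messages_nonempty : P.messages.Nonempty := by
  have h := P.q_prime.two_le
  have h' := P.two_le_b
  exact ⟨(1, 1, 0), by
    simp only [messages, Finset.mem_product, Finset.mem_Icc, Finset.mem_range]; omega⟩

/-- A blanket noise: a uniformly random message. -/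
noncomputable def blanket : PMF Message := PMF.uniformOfFinset P.messages P.messages_nonempty

/-- The coin `Ber(ρ - ⌊ρ⌋)`. -/
noncomputable def coin : PMF Bool :=
  PMF.bernoulli (Int.fract P.rho).toNNReal
    (Real.toNNReal_le_one.mpr (Int.fract_lt_one P.rho).le)

/-- The blanket noises of one user: `⌊ρ⌋` of them, and one more with probability `ρ - ⌊ρ⌋`. -/
noncomputable def noise : PMF (Multiset Message) :=
  (iidMultiset P.blanket ⌊P.rho⌋₊).bind fun T =>
    P.coin.bind fun y =>
      if y then P.blanket.bind fun m => PMF.pure (m ::ₘ T) else PMF.pure T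

/-- The local randomizer. -/
noncomputable def randomizer (x : Dom P.B) : PMF (Multiset Message) :=
  (PMF.uniformOfFinset P.seeds P.seeds_nonempty).bind fun s =>
    P.noise.bind fun T => PMF.pure ((s.1, s.2, P.hash s.1 s.2 x) ::ₘ T)

/-- The analyzer: count the tuples `(u, v, w)` with `h_{u,v}(x) = w` and correct the bias. -/
noncomputable def analyzer (T : Multiset Message) (x : Dom P.B) : ℝ :=
  ((T.countP fun m => P.hash m.1 m.2.1 x = m.2.2 : ℕ) - (n : ℝ) * P.rho / (P.b : ℝ)
    - (n : ℝ) * P.pcol) / (1 - P.pcol)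

/-- What the analyzer sees: the shuffled messages of all `n` users. -/
noncomputable def view (D : Fin n → Dom P.B) : PMF (Multiset Message) :=
  shuffleView P.randomizer D

/-- The whole protocol, from the dataset to the vector of estimated frequencies. -/
noncomputable def protocol (D : Fin n → Dom P.B) : PMF (Dom P.B → ℝ) :=
  (P.view D).map P.analyzer

/-- The scale `ε² n / log (1/δ)`. -/
noncomputable def scale : ℝ := P.ε ^ 2 * (n : ℝ) / Real.log (1 / P.δ)

end FE1

/-! Say that a message `(u, v, w)` supports `x` if `h_{u,v}(x) = w`, and let `N_x` count the
supporting messages.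

Privacy. The data-dependent message of a user holding `x` has the law of a blanket noise conditioned
on supporting `x`, an event of probability `1/b`. By exchangeability, this message together with `k`
independent noises has density `b * N_x / (k+1)` with respect to `k+1` independent noises
(`lexp_convolve_sample_iidMultiset`). The likelihood ratio of two inputs is therefore `N_x / N_x'`,
whatever `k` is, so the random number of noises does no harm. It remains to see that `N_x ≤ exp ε *
N_x'` fails with probability at most `δ`. The noise part of either count has exponential moments
bounded by those of a Poisson variable of mean `μ = nρ/b = 32 log(2/δ) / ε²`, so Chernoff bounds
give noise counts below `μ(1+ε/3)` for `x` and above `μ(1-ε/4)` for `x'`, each failing with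
probability at most `δ/2`. The data-dependent messages of the other users are an independent summand
and only translate the event.

Communication. A user sends exactly `1 + ρ` messages in expectation, and `ρ = O(f n)` because `b ≤ 2
f(n) ε² n / log(1/δ)` and `log(2/δ) = O(log(1/δ))` for `δ` away from `1`.

Accuracy. Evaluation at two distinct points of `[B]` maps the seeds bijectively onto ordered pairs
of distinct residues modulo `q`, so the collision probability is exactly `pcol` and the estimator is
unbiased. The count is a sum of independent terms with variance proxy `V = n/b + μ`; the lower bound
on `f` makes `V ε²` polylogarithmic. A Bernstein-type bound and a union bound over `[B]` finish the
proof. -/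

/-! ### Expectations of `[0, ∞]`-valued functions under a `PMF` -/

/-- The expectation of a `[0, ∞]`-valued function. -/
noncomputable def lexp {α : Type} (p : PMF α) (g : α → ℝ≥0∞) : ℝ≥0∞ := ∑' a, p a * g a

section Lexp

variable {α β : Type}

theorem lexp_pure (a : α) (g : α → ℝ≥0∞) : lexp (PMF.pure a) g = g a := by
  classical
  rw [lexp, tsum_eq_single a]
  · simp
  · intro b hb
    simp [PMF.pure_apply, hb]

theorem lexp_bind (p : PMF α) (k : α → PMF β) (g : β → ℝ≥0∞) :
    lexp (p.bind k) g = lexp p fun a => lexp (k a) g := by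
  simp only [lexp, PMF.bind_apply, ← ENNReal.tsum_mul_right, ← ENNReal.tsum_mul_left]
  rw [ENNReal.tsum_comm]
  simp only [mul_assoc]

theorem lexp_mono (p : PMF α) {g h : α → ℝ≥0∞} (H : ∀ a, g a ≤ h a) : lexp p g ≤ lexp p h :=
  ENNReal.tsum_le_tsum fun a => mul_le_mul_right (H a) _

theorem lexp_add (p : PMF α) (g h : α → ℝ≥0∞) :
    lexp p (fun a => g a + h a) = lexp p g + lexp p h := by
  simp only [lexp, mul_add, ENNReal.tsum_add]

theorem lexp_const_mul (p : PMF α) (c : ℝ≥0∞) (g : α → ℝ≥0∞) :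
    lexp p (fun a => c * g a) = c * lexp p g := by
  simp only [lexp, ← ENNReal.tsum_mul_left, mul_left_comm]

theorem lexp_mul_const (p : PMF α) (c : ℝ≥0∞) (g : α → ℝ≥0∞) :
    lexp p (fun a => g a * c) = lexp p g * c := by
  simp only [lexp, ← ENNReal.tsum_mul_right, mul_assoc]

theorem lexp_const (p : PMF α) (c : ℝ≥0∞) : lexp p (fun _ => c) = c := by
  rw [lexp, ENNReal.tsum_mul_right, p.tsum_coe, one_mul]

theorem toOuterMeasure_eq_lexp (p : PMF α) (S : Set α) :
    p.toOuterMeasure S = lexp p (S.indicator 1) := by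
  classical
  rw [PMF.toOuterMeasure_apply, lexp]
  refine tsum_congr fun a => ?_
  by_cases h : a ∈ S <;> simp [h]

theorem lexp_uniformOfFinset (s : Finset α) (hs : s.Nonempty) (g : α → ℝ≥0∞) :
    lexp (PMF.uniformOfFinset s hs) g = (s.card : ℝ≥0∞)⁻¹ * ∑ a ∈ s, g a := by
  rw [lexp, tsum_eq_sum (s := s), Finset.mul_sum]
  · exact Finset.sum_congr rfl fun a ha => by rw [PMF.uniformOfFinset_apply_of_mem hs ha]
  · intro a ha
    rw [PMF.uniformOfFinset_apply_of_notMem hs ha, zero_mul]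

theorem ext_of_lexp {p q : PMF α} (h : ∀ g, lexp p g = lexp q g) : p = q := by
  classical
  ext a
  have := h (Pi.single a 1)
  rw [lexp, lexp, tsum_eq_single a, tsum_eq_single a] at this
  · simpa using this
  · intro b hb; simp [hb]
  · intro b hb; simp [hb]

/-- Markov's inequality. -/
theorem toOuterMeasure_le_mul_lexp (p : PMF α) (S : Set α) (c : ℝ≥0∞) (g : α → ℝ≥0∞)
    (H : ∀ a ∈ S, 1 ≤ c * g a) : p.toOuterMeasure S ≤ c * lexp p g := by
  classical
  rw [toOuterMeasure_eq_lexp, ← lexp_const_mul]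
  refine lexp_mono p fun a => ?_
  by_cases h : a ∈ S
  · simpa [h] using H a h
  · simp [h]

end Lexp

/-! ### Independent sums of random multisets -/

/-- The law of the sum of two independent random multisets. -/
noncomputable def convolve {M : Type} (p q : PMF (Multiset M)) : PMF (Multiset M) :=
  p.bind fun S => q.bind fun T => PMF.pure (S + T)

section Convolve

variable {M X : Type}

theorem lexp_convolve (p q : PMF (Multiset M)) (g : Multiset M → ℝ≥0∞) :
    lexp (convolve p q) g = lexp p fun S => lexp q fun T => g (S + T) := by
  simp only [convolve, lexp_bind, lexp_pure]

theorem convolve_comm (p q : PMF (Multiset M)) : convolve p q = convolve q p := by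
  rw [convolve, PMF.bind_comm]
  simp only [convolve, add_comm]

theorem convolve_assoc (p q r : PMF (Multiset M)) :
    convolve (convolve p q) r = convolve p (convolve q r) := by
  simp only [convolve, PMF.bind_bind, PMF.pure_bind, add_assoc]

theorem convolve_left_comm (p q r : PMF (Multiset M)) :
    convolve p (convolve q r) = convolve q (convolve p r) := by
  rw [← convolve_assoc, convolve_comm p q, convolve_assoc]

theorem pure_zero_convolve (p : PMF (Multiset M)) : convolve (PMF.pure 0) p = p := by
  simp only [convolve, PMF.pure_bind, zero_add, PMF.bind_pure]

/-- Independence in the form needed for moment generating functions; it is applied with `φ =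
expCount A t`. -/
theorem lexp_convolve_mul {φ : Multiset M → ℝ≥0∞} (hφ : ∀ S T, φ (S + T) = φ S * φ T)
    (p q : PMF (Multiset M)) : lexp (convolve p q) φ = lexp p φ * lexp q φ := by
  simp only [lexp_convolve, hφ, lexp_const_mul, lexp_mul_const]

/-- The law of the sum of `n` independent random multisets with the same law. -/
noncomputable def convolvePow (p : PMF (Multiset M)) : ℕ → PMF (Multiset M)
  | 0 => PMF.pure 0
  | n + 1 => convolve p (convolvePow p n)

theorem lexp_convolvePow {φ : Multiset M → ℝ≥0∞} (h0 : φ 0 = 1)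
    (hφ : ∀ S T, φ (S + T) = φ S * φ T) (p : PMF (Multiset M)) (n : ℕ) :
    lexp (convolvePow p n) φ = lexp p φ ^ n := by
  induction n with
  | zero => rw [convolvePow, lexp_pure, h0, pow_zero]
  | succ n ih => rw [convolvePow, lexp_convolve_mul hφ, ih, pow_succ']

theorem shuffleView_succ (R : X → PMF (Multiset M)) {n : ℕ} (D : Fin (n + 1) → X) :
    shuffleView R D = convolve (R (D 0)) (shuffleView R (Fin.tail D)) := rfl

/-- Shuffling forgets the senders: convolution is commutative, so the noises of all users collect in
one factor that does not depend on the data. -/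
theorem shuffleView_convolve (R : X → PMF (Multiset M)) (q : PMF (Multiset M)) {n : ℕ}
    (D : Fin n → X) :
    shuffleView (fun x => convolve (R x) q) D = convolve (shuffleView R D) (convolvePow q n) := by
  induction n with
  | zero => simp only [shuffleView, convolvePow, pure_zero_convolve]
  | succ n ih =>
    rw [shuffleView_succ, shuffleView_succ, ih, convolvePow, convolve_assoc, convolve_assoc,
      convolve_left_comm q]

theorem lexp_shuffleView {φ : Multiset M → ℝ≥0∞} (h0 : φ 0 = 1)
    (hφ : ∀ S T, φ (S + T) = φ S * φ T) (R : X → PMF (Multiset M)) {n : ℕ} (D : Fin n → X) :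
    lexp (shuffleView R D) φ = ∏ i, lexp (R (D i)) φ := by
  induction n with
  | zero => simp only [shuffleView, lexp_pure, h0, Finset.univ_eq_empty, Finset.prod_empty]
  | succ n ih => rw [shuffleView_succ, lexp_convolve_mul hφ, ih, Fin.prod_univ_succ]; rfl

/-- The contribution of one user can be split off from the view of the analyzer. -/
theorem exists_shuffleView_eq_convolve (R : X → PMF (Multiset M)) {n : ℕ} (i : Fin n)
    (D D' : Fin n → X) (h : ∀ j, j ≠ i → D j = D' j) :
    ∃ Q, shuffleView R D = convolve (R (D i)) Q ∧ shuffleView R D' = convolve (R (D' i)) Q := by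
  induction n with
  | zero => exact i.elim0
  | succ n ih =>
    induction i using Fin.cases with
    | zero =>
      refine ⟨shuffleView R (Fin.tail D), shuffleView_succ R D, ?_⟩
      rw [shuffleView_succ, show Fin.tail D' = Fin.tail D from
        funext fun j => (h j.succ (Fin.succ_ne_zero j)).symm]
    | succ i =>
      obtain ⟨Q, h1, h2⟩ := ih i (Fin.tail D) (Fin.tail D') fun j hj =>
        h j.succ fun e => hj (Fin.succ_injective _ e)
      refine ⟨convolve (R (D 0)) Q, ?_, ?_⟩
      · rw [shuffleView_succ, h1, convolve_left_comm]; rfl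
      · rw [shuffleView_succ, h2, convolve_left_comm, h 0 (Fin.succ_ne_zero i).symm]; rfl

end Convolve

/-! ### Independent samples -/

section Iid

variable {M : Type}

theorem lexp_iidMultiset_succ (p : PMF M) (k : ℕ) (g : Multiset M → ℝ≥0∞) :
    lexp (iidMultiset p (k + 1)) g =
      lexp (iidMultiset p k) fun T => lexp p fun a => g (a ::ₘ T) := by
  simp only [iidMultiset, lexp_bind, lexp_pure]

theorem lexp_lexp_comm {α β : Type} (p : PMF α) (q : PMF β) (g : α → β → ℝ≥0∞) :
    (lexp p fun a => lexp q fun b => g a b) = lexp q fun b => lexp p fun a => g a b := by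
  simp only [lexp, ← ENNReal.tsum_mul_left]
  rw [ENNReal.tsum_comm]
  simp only [mul_left_comm]

theorem lexp_iidMultiset {φ : Multiset M → ℝ≥0∞} (h0 : φ 0 = 1)
    (hφ : ∀ S T, φ (S + T) = φ S * φ T) (p : PMF M) (k : ℕ) :
    lexp (iidMultiset p k) φ = (lexp p fun a => φ {a}) ^ k := by
  induction k with
  | zero => rw [iidMultiset, lexp_pure, h0, pow_zero]
  | succ k ih =>
    rw [lexp_iidMultiset_succ]
    simp only [← Multiset.singleton_add, hφ, lexp_mul_const, lexp_const_mul]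
    rw [ih, pow_succ']

theorem convolve_iidMultiset (p : PMF M) (j k : ℕ) :
    convolve (iidMultiset p j) (iidMultiset p k) = iidMultiset p (j + k) := by
  refine ext_of_lexp fun g => ?_
  induction k generalizing g with
  | zero => simp only [lexp_convolve, iidMultiset, lexp_pure, add_zero]
  | succ k ih =>
    rw [← add_assoc, lexp_iidMultiset_succ, ← ih]
    simp only [lexp_convolve, lexp_iidMultiset_succ, Multiset.add_cons]

/-- Each of `k + 1` independent samples contributes the same amount to the sum over the samples in
`A` of a symmetric function. -/
theorem lexp_iidMultiset_countP_mul (p : PMF M) (A : M → Prop) [DecidablePred A] (k : ℕ)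
    (g : Multiset M → ℝ≥0∞) :
    (lexp (iidMultiset p (k + 1)) fun T => (T.countP A : ℝ≥0∞) * g T) =
      (k + 1 : ℕ) * lexp (iidMultiset p k) fun T => lexp p fun a =>
        (if A a then 1 else 0) * g (a ::ₘ T) := by
  induction k generalizing g with
  | zero =>
    rw [lexp_iidMultiset_succ]
    simp [iidMultiset, lexp_pure, Multiset.countP_cons]
  | succ k ih =>
    rw [lexp_iidMultiset_succ]
    -- The counted sample is either among the earlier ones, where induction applies to `g` averaged
    -- over the newest sample, or it is the newest.
    have h1 : ∀ T : Multiset M, (lexp p fun a => ((a ::ₘ T).countP A : ℝ≥0∞) * g (a ::ₘ T)) =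
        T.countP A * (lexp p fun a => g (a ::ₘ T)) +
          lexp p fun a => (if A a then 1 else 0) * g (a ::ₘ T) := by
      intro T
      rw [← lexp_const_mul, ← lexp_add]
      congr 1
      funext a
      rw [Multiset.countP_cons]
      push_cast
      rw [add_mul]
    simp only [h1]
    rw [lexp_add, ih fun T => lexp p fun a => g (a ::ₘ T)]
    rw [lexp_iidMultiset_succ]
    -- The last two samples are exchangeable.
    have h2 : ∀ T : Multiset M,
        (lexp p fun a => (if A a then 1 else 0) * lexp p fun a' => g (a' ::ₘ a ::ₘ T)) =
        lexp p fun a => lexp p fun a' => (if A a' then 1 else 0) * g (a' ::ₘ a ::ₘ T) := by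
      intro T
      rw [lexp_lexp_comm p p]
      congr 1
      funext a
      rw [← lexp_const_mul]
      congr 1
      funext a'
      rw [Multiset.cons_swap]
    simp only [h2]
    push_cast
    ring

end Iid

/-! ### Exponential moments of counts -/

section ExpCount

variable {M : Type} (A : M → Prop) [DecidablePred A]

/-- The exponential `exp (t * #{m ∈ T | A m})`. -/
noncomputable def expCount (t : ℝ) (T : Multiset M) : ℝ≥0∞ :=
  ENNReal.ofReal (Real.exp (t * (T.countP A : ℕ)))

theorem expCount_zero (t : ℝ) : expCount A t 0 = 1 := by simp [expCount]

theorem expCount_add (t : ℝ) (S T : Multiset M) :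
    expCount A t (S + T) = expCount A t S * expCount A t T := by
  rw [expCount, expCount, expCount, ← ENNReal.ofReal_mul (Real.exp_pos _).le, ← Real.exp_add,
    Multiset.countP_add]
  push_cast
  rw [mul_add]

theorem expCount_singleton (t : ℝ) (a : M) :
    expCount A t {a} = ENNReal.ofReal (if A a then Real.exp t else 1) := by
  rw [expCount, ← Multiset.cons_zero, Multiset.countP_cons]
  by_cases h : A a <;> simp [h]

/-- The exponential Markov inequality, for the upper tail if `0 ≤ t` and the lower tail if
`t ≤ 0`. -/
theorem toOuterMeasure_le_exp_mul_lexp (p : PMF (Multiset M)) (t c : ℝ) (S : Set (Multiset M))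
    (H : ∀ T ∈ S, t * c ≤ t * (T.countP A : ℕ)) :
    p.toOuterMeasure S ≤ ENNReal.ofReal (Real.exp (-(t * c))) * lexp p (expCount A t) := by
  refine toOuterMeasure_le_mul_lexp p S _ _ fun T hT => ?_
  rw [expCount, ← ENNReal.ofReal_mul (Real.exp_pos _).le, ← Real.exp_add, ENNReal.one_le_ofReal,
    Real.one_le_exp_iff]
  linarith [H T hT]

end ExpCount

/-! ### Estimates for real functions -/

theorem Real.exp_neg_le_quadratic {x : ℝ} (hx : 0 ≤ x) :
    Real.exp (-x) ≤ 1 - x + x ^ 2 / 2 := by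
  have h := Real.quadratic_le_exp_of_nonneg hx
  rw [Real.exp_neg, inv_le_iff_one_le_mul₀ (Real.exp_pos x)]
  have h0 : 0 ≤ 1 - x + x ^ 2 / 2 := by nlinarith [sq_nonneg (x - 1)]
  -- `(1 - x + x²/2)(1 + x + x²/2) = 1 + x⁴/4`.
  nlinarith [mul_le_mul_of_nonneg_left h h0, sq_nonneg (x ^ 2)]

/-- Chernoff exponent at the optimal `t = log (1 + y)`, with `y = ε/3`. The bound `log (1+y) ≥
2y/(y+2)` gives `(1+y) log (1+y) - y ≥ y²/(y+2)`, which is at least `ε²/27` for `ε ≤ 3`. -/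
theorem poisson_upper_exponent {μ L ε : ℝ} (hε : 0 < ε) (hε3 : ε ≤ 3) (hμ0 : 0 ≤ μ)
    (hμ : μ * ε ^ 2 = 32 * L) :
    -(Real.log (1 + ε / 3) * (μ * (1 + ε / 3))) + μ * (Real.exp (Real.log (1 + ε / 3)) - 1)
      ≤ -L := by
  rw [Real.exp_log (by positivity)]
  have h := Real.le_log_one_add_of_nonneg (x := ε / 3) (by positivity)
  have h2 : ε ^ 2 / 32 ≤ Real.log (1 + ε / 3) * (1 + ε / 3) - ε / 3 := by
    have h3 : ε ^ 2 / 32 + ε / 3 ≤ 2 * (ε / 3) / (ε / 3 + 2) * (1 + ε / 3) := by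
      rw [div_mul_eq_mul_div, le_div_iff₀ (by positivity)]
      nlinarith [mul_pos hε hε]
    nlinarith [mul_le_mul_of_nonneg_right h (by positivity : 0 ≤ 1 + ε / 3)]
  nlinarith [mul_le_mul_of_nonneg_left h2 hμ0]

/-- At `t = -ε/4` the quadratic bound gives the exponent `-με²/32`, which is exactly `-L`: the
constant `32` of the protocol is used up here. -/
theorem poisson_lower_exponent {μ L ε : ℝ} (hε : 0 < ε) (hμ0 : 0 ≤ μ)
    (hμ : μ * ε ^ 2 = 32 * L) :
    -(-(ε / 4) * (μ * (1 - ε / 4))) + μ * (Real.exp (-(ε / 4)) - 1) ≤ -L := by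
  have h := Real.exp_neg_le_quadratic (x := ε / 4) (by positivity)
  nlinarith [mul_le_mul_of_nonneg_left h hμ0]

/-- The summand `1` is the user's own message. It is absorbed by the slack `με²/16 = 2L ≥ 1` in `exp
ε * (1 - ε/4) ≥ 1 + ε/3 + ε²/16`, which follows from the cubic Taylor bound. -/
theorem one_add_le_exp_mul {μ L ε : ℝ} (hε : 0 < ε) (hε3 : ε ≤ 3) (hμ0 : 0 ≤ μ)
    (hL : 1 / 2 ≤ L) (hμ : μ * ε ^ 2 = 32 * L) :
    1 + μ * (1 + ε / 3) ≤ Real.exp ε * (μ * (1 - ε / 4)) := by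
  have h := Real.sum_le_exp_of_nonneg hε.le 4
  simp only [Finset.sum_range_succ, Finset.sum_range_zero, Nat.factorial] at h
  norm_num at h
  have h1 : 1 + ε / 3 + ε ^ 2 / 16 ≤ Real.exp ε * (1 - ε / 4) := by
    have h2 := mul_le_mul_of_nonneg_right h (by linarith : 0 ≤ 1 - ε / 4)
    nlinarith [mul_nonneg hε.le (sub_nonneg.2 hε3),
      mul_nonneg (mul_nonneg hε.le hε.le) (sub_nonneg.2 hε3),
      mul_nonneg (mul_nonneg (mul_nonneg hε.le hε.le) hε.le) (sub_nonneg.2 hε3)]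
  nlinarith [mul_le_mul_of_nonneg_left h1 hμ0]

namespace FE1

variable {n : ℕ} (P : FE1 n)

/-! ### The messages of one user -/

theorem b_pos : 0 < P.b := lt_of_lt_of_le two_pos P.two_le_b

theorem hash_lt (u v x : ℕ) : P.hash u v x < P.b := Nat.mod_lt _ P.b_pos

/-- The message `m` supports the element `x`. -/
def Supports (x : ℕ) (m : Message) : Prop := P.hash m.1 m.2.1 x = m.2.2

instance (x : ℕ) : DecidablePred (P.Supports x) := fun m =>
  inferInstanceAs (Decidable (P.hash m.1 m.2.1 x = m.2.2))

/-- A uniformly random seed of the hash family. -/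
noncomputable def seed : PMF (ℕ × ℕ) := PMF.uniformOfFinset P.seeds P.seeds_nonempty

/-- The message of a user that depends on the input. -/
noncomputable def sample (x : ℕ) : PMF (Multiset Message) :=
  P.seed.bind fun s => PMF.pure {(s.1, s.2, P.hash s.1 s.2 x)}

theorem lexp_sample (x : ℕ) (g : Multiset Message → ℝ≥0∞) :
    lexp (P.sample x) g = lexp P.seed fun s => g {(s.1, s.2, P.hash s.1 s.2 x)} := by
  simp only [sample, lexp_bind, lexp_pure]

theorem randomizer_eq (x : Dom P.B) : P.randomizer x = convolve (P.sample x) P.noise := by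
  simp only [randomizer, sample, convolve, PMF.bind_bind, PMF.pure_bind, Multiset.singleton_add]
  rfl

theorem view_eq (D : Fin n → Dom P.B) :
    P.view D = convolve (shuffleView (fun x : Dom P.B => P.sample x) D)
      (convolvePow P.noise n) := by
  rw [view, show P.randomizer = fun x : Dom P.B => convolve (P.sample x) P.noise from
    funext P.randomizer_eq, shuffleView_convolve]

theorem card_messages : P.messages.card = P.seeds.card * P.b := by
  simp only [messages, seeds, Finset.card_product, Finset.card_range, mul_assoc]

/-- The data-dependent message is a blanket noise conditioned on supporting the input. -/
theorem lexp_blanket_supports (x : ℕ) (g : Message → ℝ≥0∞) :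
    (lexp P.blanket fun m => (if P.Supports x m then 1 else 0) * g m) =
      (P.b : ℝ≥0∞)⁻¹ * lexp P.seed fun s => g (s.1, s.2, P.hash s.1 s.2 x) := by
  rw [blanket, seed, lexp_uniformOfFinset, lexp_uniformOfFinset, card_messages, ← mul_assoc]
  congr 1
  · rw [Nat.cast_mul, ENNReal.mul_inv (Or.inr (by simp)) (Or.inl (by simp)), mul_comm]
  · rw [messages, seeds, Finset.sum_product, Finset.sum_product]
    refine Finset.sum_congr rfl fun u _ => ?_
    rw [Finset.sum_product]
    refine Finset.sum_congr rfl fun v _ => ?_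
    rw [Finset.sum_eq_single (P.hash u v x)]
    · rw [if_pos (show P.Supports x (u, v, P.hash u v x) from rfl), one_mul]
    · intro w _ hw
      rw [if_neg (fun h : P.Supports x (u, v, w) => hw h.symm), zero_mul]
    · exact fun h => absurd (Finset.mem_range.2 (P.hash_lt u v x)) h

theorem lexp_blanket_expCount (x : ℕ) (t : ℝ) :
    (lexp P.blanket fun m => expCount (P.Supports x) t {m}) =
      ENNReal.ofReal (1 + (Real.exp t - 1) / P.b) := by
  have hb : (0 : ℝ) < P.b := Nat.cast_pos.2 P.b_pos
  have hprob : (lexp P.blanket fun m => if P.Supports x m then (1 : ℝ≥0∞) else 0) =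
      ENNReal.ofReal (1 / P.b) := by
    have h := P.lexp_blanket_supports x fun _ => 1
    simp only [mul_one, lexp_const] at h
    rw [h, one_div, ENNReal.ofReal_inv_of_pos hb, ENNReal.ofReal_natCast]
  have hcompl : (lexp P.blanket fun m => if P.Supports x m then (0 : ℝ≥0∞) else 1) =
      ENNReal.ofReal (1 - 1 / P.b) := by
    have h : (lexp P.blanket fun m => if P.Supports x m then (0 : ℝ≥0∞) else 1) +
        (lexp P.blanket fun m => if P.Supports x m then (1 : ℝ≥0∞) else 0) = 1 := by
      rw [← lexp_add]
      refine (congrArg (lexp P.blanket) (funext fun m => ?_)).trans (lexp_const P.blanket 1)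
      split_ifs <;> simp
    rw [hprob] at h
    rw [ENNReal.ofReal_sub _ (by positivity), ENNReal.ofReal_one]
    exact ENNReal.eq_sub_of_add_eq ENNReal.ofReal_ne_top h
  have hsplit : ∀ m, expCount (P.Supports x) t {m} =
      ENNReal.ofReal (Real.exp t) * (if P.Supports x m then 1 else 0) +
        (if P.Supports x m then 0 else 1) := by
    intro m
    rw [expCount_singleton]
    split_ifs <;> simp
  have hb1 : 1 / (P.b : ℝ) ≤ 1 := by
    rw [div_le_one hb]; exact_mod_cast P.b_pos
  simp only [hsplit]
  rw [lexp_add, lexp_const_mul, hprob, hcompl, ← ENNReal.ofReal_mul (Real.exp_pos t).le,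
    ← ENNReal.ofReal_add (by positivity) (by linarith)]
  congr 1
  ring

/-! ### The blanket noises -/

theorem rho_nonneg : 0 ≤ P.rho := by
  have h : 0 ≤ Real.log (2 / P.δ) :=
    Real.log_nonneg (by rw [le_div_iff₀ P.δ_pos]; linarith [P.δ_lt])
  have := P.ε_pos
  rw [rho]
  positivity

theorem floor_add_fract_rho : (⌊P.rho⌋₊ : ℝ) + Int.fract P.rho = P.rho := by
  rw [natCast_floor_eq_intCast_floor P.rho_nonneg, Int.floor_add_fract]

theorem noise_eq :
    P.noise = P.coin.bind fun y => iidMultiset P.blanket (⌊P.rho⌋₊ + y.toNat) := by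
  rw [noise, PMF.bind_comm]
  congr 1
  funext y
  cases y
  · simp
  · simp [iidMultiset]

theorem lexp_coin (g : Bool → ℝ≥0∞) :
    lexp P.coin g = ENNReal.ofReal (1 - Int.fract P.rho) * g false +
      ENNReal.ofReal (Int.fract P.rho) * g true := by
  rw [lexp, tsum_fintype, Fintype.sum_bool, add_comm]
  congr 2
  rw [ENNReal.ofReal_sub _ (Int.fract_nonneg _), ENNReal.ofReal_one]
  rfl

/-- With `z = (exp t - 1)/b`, the moment equals `(1+z)^⌊ρ⌋ * (1 + fract ρ * z) ≤ exp (ρ z)`, so a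
fractional `ρ` costs nothing compared with a Poisson variable of mean `ρ/b`. -/
theorem lexp_noise_expCount_le (x : ℕ) (t : ℝ) :
    lexp P.noise (expCount (P.Supports x) t) ≤
      ENNReal.ofReal (Real.exp (P.rho / P.b * (Real.exp t - 1))) := by
  have hb : (1 : ℝ) ≤ P.b := by exact_mod_cast P.b_pos
  set z : ℝ := (Real.exp t - 1) / P.b with hz
  have hz1 : 0 ≤ 1 + z := by
    have : -1 ≤ z := by
      rw [hz, le_div_iff₀ (by linarith)]
      linarith [Real.exp_pos t]
    linarith
  have hf0 := Int.fract_nonneg P.rho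
  have hf1 := (Int.fract_lt_one P.rho).le
  rw [noise_eq, lexp_bind, lexp_coin]
  simp only [lexp_iidMultiset (expCount_zero _ t) (expCount_add _ t), lexp_blanket_expCount,
    ← hz, Bool.toNat_true, Bool.toNat_false, add_zero]
  rw [← ENNReal.ofReal_pow hz1, ← ENNReal.ofReal_pow hz1,
    ← ENNReal.ofReal_mul (by linarith), ← ENNReal.ofReal_mul hf0,
    ← ENNReal.ofReal_add (mul_nonneg (by linarith) (pow_nonneg hz1 _))
      (mul_nonneg hf0 (pow_nonneg hz1 _))]
  refine ENNReal.ofReal_le_ofReal ?_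
  have h1 : (1 + z) ^ ⌊P.rho⌋₊ ≤ Real.exp (⌊P.rho⌋₊ * z) := by
    rw [Real.exp_nat_mul]
    exact pow_le_pow_left₀ hz1 (by linarith [Real.add_one_le_exp z]) _
  have h2 : 1 + Int.fract P.rho * z ≤ Real.exp (Int.fract P.rho * z) := by
    linarith [Real.add_one_le_exp (Int.fract P.rho * z)]
  have h3 : 0 ≤ 1 + Int.fract P.rho * z := by nlinarith
  calc (1 - Int.fract P.rho) * (1 + z) ^ ⌊P.rho⌋₊ + Int.fract P.rho * (1 + z) ^ (⌊P.rho⌋₊ + 1)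
      = (1 + z) ^ ⌊P.rho⌋₊ * (1 + Int.fract P.rho * z) := by ring
    _ ≤ Real.exp (⌊P.rho⌋₊ * z) * Real.exp (Int.fract P.rho * z) :=
        mul_le_mul h1 h2 h3 (Real.exp_pos _).le
    _ = Real.exp (P.rho / P.b * (Real.exp t - 1)) := by
        rw [← Real.exp_add, ← add_mul, floor_add_fract_rho, hz]
        congr 1
        ring

/-- The expected number of blanket noises that support a given element. -/
noncomputable def noiseMean : ℝ := n * P.rho / P.b

theorem noiseMean_nonneg : 0 ≤ P.noiseMean := by
  have := P.rho_nonneg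
  rw [noiseMean]
  positivity

theorem lexp_convolvePow_noise_expCount_le (x : ℕ) (t : ℝ) :
    lexp (convolvePow P.noise n) (expCount (P.Supports x) t) ≤
      ENNReal.ofReal (Real.exp (P.noiseMean * (Real.exp t - 1))) := by
  rw [lexp_convolvePow (expCount_zero _ t) (expCount_add _ t)]
  refine (pow_le_pow_left' (P.lexp_noise_expCount_le x t) n).trans_eq ?_
  rw [← ENNReal.ofReal_pow (Real.exp_pos _).le, ← Real.exp_nat_mul, noiseMean]
  congr 2
  ring

/-- Only the number of noises is not fixed; given that number they are independent and uniform. This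
reduces privacy to a fixed number of noises. -/
theorem exists_convolvePow_noise_eq (k : ℕ) :
    ∃ ν : PMF ℕ, convolvePow P.noise k = ν.bind (iidMultiset P.blanket) := by
  induction k with
  | zero => exact ⟨PMF.pure 0, by rw [PMF.pure_bind]; rfl⟩
  | succ k ih =>
    obtain ⟨ν, hν⟩ := ih
    refine ⟨P.coin.bind fun y => ν.bind fun j => PMF.pure (⌊P.rho⌋₊ + y.toNat + j), ?_⟩
    rw [convolvePow, hν, noise_eq]
    refine ext_of_lexp fun g => ?_
    simp only [lexp_convolve, lexp_bind, lexp_pure]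
    congr 1
    funext y
    rw [lexp_lexp_comm]
    congr 1
    funext j
    rw [← convolve_iidMultiset P.blanket (⌊P.rho⌋₊ + y.toNat) j, lexp_convolve]

/-! ### Privacy -/

/-- The density formula: conditioning one of `k+1` exchangeable noises on supporting `x` reweights
the multiset by the number of its messages that support `x`. The other factors do not depend on `x`.
-/
theorem lexp_convolve_sample_iidMultiset (x k : ℕ) (g : Multiset Message → ℝ≥0∞) :
    lexp (convolve (P.sample x) (iidMultiset P.blanket k)) g =
      P.b * ((k + 1 : ℕ) : ℝ≥0∞)⁻¹ * lexp (iidMultiset P.blanket (k + 1)) fun T =>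
        (T.countP (P.Supports x) : ℝ≥0∞) * g T := by
  have hb : (P.b : ℝ≥0∞) ≠ 0 := Nat.cast_ne_zero.2 P.b_pos.ne'
  rw [lexp_iidMultiset_countP_mul]
  simp only [lexp_blanket_supports]
  rw [lexp_const_mul, lexp_convolve, lexp_sample, lexp_lexp_comm]
  simp only [Multiset.singleton_add]
  rw [mul_assoc, ← mul_assoc _ ((k + 1 : ℕ) : ℝ≥0∞),
    ENNReal.inv_mul_cancel (by simp) (ENNReal.natCast_ne_top _), one_mul, ← mul_assoc,
    ENNReal.mul_inv_cancel hb (ENNReal.natCast_ne_top _), one_mul]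

theorem lexp_convolve_sample_mixture (x : ℕ) (ν : PMF ℕ) (g : Multiset Message → ℝ≥0∞) :
    lexp (convolve (P.sample x) (ν.bind (iidMultiset P.blanket))) g =
      lexp ν fun k => lexp (convolve (P.sample x) (iidMultiset P.blanket k)) g := by
  simp only [lexp_convolve, lexp_bind]
  rw [lexp_lexp_comm]

/-- Hidden among a random number of blanket noises, the messages of two inputs are
indistinguishable up to the event that the supports of the two inputs are out of proportion. -/
theorem toOuterMeasure_convolve_sample_mixture_le (x x' : ℕ) (ν : PMF ℕ) (c : ℝ≥0∞)
    (S : Set (Multiset Message)) :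
    (convolve (P.sample x) (ν.bind (iidMultiset P.blanket))).toOuterMeasure S ≤
      c * (convolve (P.sample x') (ν.bind (iidMultiset P.blanket))).toOuterMeasure S +
      (convolve (P.sample x) (ν.bind (iidMultiset P.blanket))).toOuterMeasure
        {T | c * (T.countP (P.Supports x') : ℝ≥0∞) < (T.countP (P.Supports x) : ℝ≥0∞)} := by
  classical
  set G : Set (Multiset Message) :=
    {T | c * (T.countP (P.Supports x') : ℝ≥0∞) < (T.countP (P.Supports x) : ℝ≥0∞)} with hG
  simp only [toOuterMeasure_eq_lexp]
  calc lexp (convolve (P.sample x) (ν.bind (iidMultiset P.blanket))) (S.indicator 1)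
      ≤ lexp (convolve (P.sample x) (ν.bind (iidMultiset P.blanket)))
          (fun T => (S \ G).indicator 1 T + G.indicator 1 T) := by
        refine lexp_mono _ fun T => ?_
        by_cases h1 : T ∈ S <;> by_cases h2 : T ∈ G <;> simp [h1, h2]
    _ ≤ _ := by
        rw [lexp_add]
        refine add_le_add ?_ le_rfl
        rw [lexp_convolve_sample_mixture, lexp_convolve_sample_mixture, ← lexp_const_mul]
        -- For each fixed `k` the two densities share the factor `b/(k+1)`, so off `G` they compare
        -- pointwise.
        refine lexp_mono _ fun k => ?_
        rw [lexp_convolve_sample_iidMultiset, lexp_convolve_sample_iidMultiset, mul_left_comm,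
          ← lexp_const_mul _ c]
        refine mul_le_mul_right ?_ _
        refine lexp_mono _ fun T => ?_
        by_cases h : T ∈ S \ G
        · have h' : (T.countP (P.Supports x) : ℝ≥0∞) ≤ c * (T.countP (P.Supports x') : ℝ≥0∞) :=
            not_lt.1 h.2
          simpa [h, h.1] using h'
        · simp [h]

/-- The choice of `ρ` makes the mean noise per element independent of `b` and `n`. -/
theorem noiseMean_mul_sq (hn : n ≠ 0) : P.noiseMean * P.ε ^ 2 = 32 * Real.log (2 / P.δ) := by
  have hb : (P.b : ℝ) ≠ 0 := Nat.cast_ne_zero.2 P.b_pos.ne'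
  have hε := P.ε_pos.ne'
  have hn' : (n : ℝ) ≠ 0 := Nat.cast_ne_zero.2 hn
  rw [noiseMean, rho]
  field_simp

theorem noise_upper_tail (hn : n ≠ 0) (x : ℕ) :
    (convolvePow P.noise n).toOuterMeasure
      {T | P.noiseMean * (1 + P.ε / 3) ≤ (T.countP (P.Supports x) : ℕ)} ≤
      ENNReal.ofReal (P.δ / 2) := by
  have hε := P.ε_pos
  have hδ := P.δ_pos
  have ht : 0 ≤ Real.log (1 + P.ε / 3) := Real.log_nonneg (by linarith)
  refine (toOuterMeasure_le_exp_mul_lexp (P.Supports x) _ (Real.log (1 + P.ε / 3))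
    (P.noiseMean * (1 + P.ε / 3)) _ fun T hT => mul_le_mul_of_nonneg_left hT ht).trans ?_
  refine (mul_le_mul_right (P.lexp_convolvePow_noise_expCount_le x _) _).trans ?_
  rw [← ENNReal.ofReal_mul (Real.exp_pos _).le, ← Real.exp_add]
  refine ENNReal.ofReal_le_ofReal ?_
  refine (Real.exp_le_exp.2 (poisson_upper_exponent hε P.ε_le P.noiseMean_nonneg
    (P.noiseMean_mul_sq hn))).trans_eq ?_
  rw [Real.exp_neg, Real.exp_log (by positivity), inv_div]

theorem noise_lower_tail (hn : n ≠ 0) (x : ℕ) :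
    (convolvePow P.noise n).toOuterMeasure
      {T | (T.countP (P.Supports x) : ℕ) ≤ P.noiseMean * (1 - P.ε / 4)} ≤
      ENNReal.ofReal (P.δ / 2) := by
  have hε := P.ε_pos
  have hδ := P.δ_pos
  refine (toOuterMeasure_le_exp_mul_lexp (P.Supports x) _ (-(P.ε / 4))
    (P.noiseMean * (1 - P.ε / 4)) _ fun T hT =>
      mul_le_mul_of_nonpos_left hT (by linarith)).trans ?_
  refine (mul_le_mul_right (P.lexp_convolvePow_noise_expCount_le x _) _).trans ?_
  rw [← ENNReal.ofReal_mul (Real.exp_pos _).le, ← Real.exp_add]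
  refine ENNReal.ofReal_le_ofReal ?_
  refine (Real.exp_le_exp.2 (poisson_lower_exponent hε P.noiseMean_nonneg
    (P.noiseMean_mul_sq hn))).trans_eq ?_
  rw [Real.exp_neg, Real.exp_log (by positivity), inv_div]

/-- The user's own message adds at most `1` to the count for `x` and at least `0` to that for `x'`,
whatever its seed. So the event forces one of the two noise tails, each of mass at most `δ/2`. -/
theorem toOuterMeasure_disproportion_le (hn : n ≠ 0) (x x' : ℕ) :
    (convolve (P.sample x) (convolvePow P.noise n)).toOuterMeasure
      {T | ENNReal.ofReal (Real.exp P.ε) * (T.countP (P.Supports x') : ℝ≥0∞) <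
        (T.countP (P.Supports x) : ℝ≥0∞)} ≤ ENNReal.ofReal P.δ := by
  classical
  have hδ := P.δ_pos
  have hL : 1 / 2 ≤ Real.log (2 / P.δ) := by
    have h : Real.log 2 ≤ Real.log (2 / P.δ) := by
      refine Real.log_le_log two_pos ?_
      rw [le_div_iff₀ hδ]
      linarith [P.δ_lt]
    linarith [Real.log_two_gt_d9]
  have key := one_add_le_exp_mul P.ε_pos P.ε_le P.noiseMean_nonneg hL (P.noiseMean_mul_sq hn)
  rw [toOuterMeasure_eq_lexp, lexp_convolve, lexp_sample]
  refine (lexp_mono _ fun s => ?_).trans_eq (lexp_const P.seed _)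
  set U : Set (Multiset Message) :=
    {T | P.noiseMean * (1 + P.ε / 3) ≤ (T.countP (P.Supports x) : ℕ)} with hU
  set V : Set (Multiset Message) :=
    {T | (T.countP (P.Supports x') : ℕ) ≤ P.noiseMean * (1 - P.ε / 4)} with hV
  calc _ ≤ lexp (convolvePow P.noise n) (fun T => U.indicator 1 T + V.indicator 1 T) := ?_
    _ ≤ ENNReal.ofReal (P.δ / 2) + ENNReal.ofReal (P.δ / 2) := by
        rw [lexp_add]
        refine add_le_add ?_ ?_
        · exact (toOuterMeasure_eq_lexp _ U).symm.trans_le (P.noise_upper_tail hn x)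
        · exact (toOuterMeasure_eq_lexp _ V).symm.trans_le (P.noise_lower_tail hn x')
    _ = ENNReal.ofReal P.δ := by
        rw [← ENNReal.ofReal_add (by positivity) (by positivity), add_halves]
  refine lexp_mono _ fun T => ?_
  by_cases hTU : T ∈ U
  · refine le_trans ?_ le_self_add
    rw [Set.indicator_of_mem hTU]
    exact Set.indicator_le_self' (fun _ _ => zero_le) _
  by_cases hTV : T ∈ V
  · refine le_trans ?_ le_add_self
    rw [Set.indicator_of_mem hTV]
    exact Set.indicator_le_self' (fun _ _ => zero_le) _
  have h1 : (T.countP (P.Supports x) : ℝ) < P.noiseMean * (1 + P.ε / 3) := not_le.1 hTU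
  have h2 : P.noiseMean * (1 - P.ε / 4) < (T.countP (P.Supports x') : ℝ) := not_le.1 hTV
  rw [Set.indicator_of_notMem]
  · exact zero_le
  rw [Set.mem_ofPred_eq, not_lt, ← ENNReal.ofReal_natCast, ← ENNReal.ofReal_natCast,
    ← ENNReal.ofReal_mul (Real.exp_pos _).le]
  refine ENNReal.ofReal_le_ofReal ?_
  rw [Multiset.singleton_add, Multiset.countP_cons, Multiset.countP_cons]
  push_cast
  have h3 : (if P.Supports x (s.1, s.2, P.hash s.1 s.2 x) then (1 : ℝ) else 0) ≤ 1 := by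
    split_ifs <;> norm_num
  have h4 : 0 ≤ (if P.Supports x' (s.1, s.2, P.hash s.1 s.2 x) then (1 : ℝ) else 0) := by
    split_ifs <;> norm_num
  calc _ ≤ 1 + P.noiseMean * (1 + P.ε / 3) := by linarith
    _ ≤ Real.exp P.ε * (P.noiseMean * (1 - P.ε / 4)) := key
    _ ≤ _ := mul_le_mul_of_nonneg_left (by linarith) (Real.exp_pos _).le

theorem isDifferentiallyPrivate_view : IsDifferentiallyPrivate P.view P.ε P.δ := by
  rintro D D' ⟨i, hi⟩ S
  have hn : n ≠ 0 := by rintro rfl; exact i.elim0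
  obtain ⟨Q, h1, h2⟩ :=
    exists_shuffleView_eq_convolve (fun x : Dom P.B => P.sample x) i D D' hi
  obtain ⟨ν, hν⟩ := P.exists_convolvePow_noise_eq n
  -- `R` stands for the data-dependent messages of the other users; for fixed `R` the event is the
  -- translate of `S` by `R`.
  have hstep : ∀ R : Multiset Message,
      lexp (convolve (P.sample (D i)) (convolvePow P.noise n))
        (fun T => S.indicator 1 (R + T)) ≤
      ENNReal.ofReal (Real.exp P.ε) * lexp (convolve (P.sample (D' i)) (convolvePow P.noise n))
        (fun T => S.indicator 1 (R + T)) + ENNReal.ofReal P.δ := by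
    intro R
    have h := P.toOuterMeasure_convolve_sample_mixture_le (D i) (D' i) ν
      (ENNReal.ofReal (Real.exp P.ε)) ((fun T => R + T) ⁻¹' S)
    rw [← hν] at h
    have h' := h.trans (add_le_add le_rfl
      (P.toOuterMeasure_disproportion_le hn (D i) (D' i)))
    rw [toOuterMeasure_eq_lexp, toOuterMeasure_eq_lexp] at h'
    exact h'
  rw [toOuterMeasure_eq_lexp, toOuterMeasure_eq_lexp, view_eq, view_eq, h1, h2,
    convolve_comm _ Q, convolve_comm _ Q, convolve_assoc, convolve_assoc, lexp_convolve,
    lexp_convolve Q]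
  refine (lexp_mono Q hstep).trans_eq ?_
  rw [lexp_add, lexp_const_mul, lexp_const]

/-! ### The number of messages -/

theorem lexp_iidMultiset_card {M : Type} (p : PMF M) (k : ℕ) :
    (lexp (iidMultiset p k) fun T => (T.card : ℝ≥0∞)) = k := by
  induction k with
  | zero => simp [iidMultiset, lexp_pure]
  | succ k ih =>
    rw [lexp_iidMultiset_succ]
    simp only [Multiset.card_cons, Nat.cast_add, Nat.cast_one, lexp_const, lexp_add, ih]

theorem expectedCard_randomizer (x : Dom P.B) :
    expectedCard (P.randomizer x) = ENNReal.ofReal (1 + P.rho) := by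
  have hf0 := Int.fract_nonneg P.rho
  have hf1 := (Int.fract_lt_one P.rho).le
  change lexp _ _ = _
  rw [randomizer_eq, lexp_convolve, lexp_sample]
  simp only [Multiset.singleton_add, Multiset.card_cons, Nat.cast_add, Nat.cast_one, lexp_add,
    lexp_const, noise_eq, lexp_bind, lexp_iidMultiset_card, lexp_coin]
  simp only [Bool.toNat_false, Bool.toNat_true, Nat.cast_zero, Nat.cast_one, mul_zero, zero_add,
    mul_one]
  rw [← ENNReal.ofReal_natCast, ← ENNReal.ofReal_one, ← ENNReal.ofReal_add (by positivity) hf0,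
    ← ENNReal.ofReal_add (by positivity) zero_le_one]
  congr 1
  linarith [P.floor_add_fract_rho]

end FE1

/-! ### The collision probability of the hash family -/

theorem card_filter_range_mod_eq {b : ℕ} (hb : 0 < b) (q y : ℕ) :
    ((Finset.range q).filter fun z => z % b = y % b).card =
      q / b + if y % b < q % b then 1 else 0 := by
  rw [← Nat.count_modEq_card q hb y, Nat.count_eq_card_filter_range]
  rfl

/-- There are `q % b` long residue classes, each with `q / b + 1` elements below `q`. -/
theorem card_filter_range_mod_lt {b : ℕ} (hb : 0 < b) (q : ℕ) :
    ((Finset.range q).filter fun y => y % b < q % b).card = q % b * (q / b + 1) := by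
  rw [Finset.card_eq_sum_card_fiberwise (f := fun y => y % b) (t := Finset.range (q % b))
    fun y hy => by simpa using (Finset.mem_filter.1 hy).2]
  rw [Finset.sum_congr rfl fun w hw => ?_, Finset.sum_const, Finset.card_range, smul_eq_mul]
  have hwq : w < q % b := Finset.mem_range.1 hw
  have hwb : w % b = w := Nat.mod_eq_of_lt (hwq.trans (Nat.mod_lt _ hb))
  have h := card_filter_range_mod_eq hb q w
  rw [hwb, if_pos hwq] at h
  rw [← h, Finset.filter_filter]
  congr 1
  refine Finset.filter_congr fun y _ => ?_
  constructor
  · exact fun h => h.2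
  · exact fun h => ⟨h ▸ hwq, h⟩

/-- The number of ordered pairs of distinct elements of `{0, …, q-1}` with the same residue. -/
theorem card_offDiag_range_mod_eq {b : ℕ} (hb : 0 < b) (q : ℕ) :
    ((((Finset.range q).offDiag.filter fun p => p.1 % b = p.2 % b).card : ℕ) : ℝ) =
      ((q / b : ℕ) : ℝ) * (((q % b : ℕ) : ℝ) + q - b) := by
  have hsplit : (((Finset.range q) ×ˢ (Finset.range q)).filter fun p => p.1 % b = p.2 % b).card =
      ((Finset.range q).offDiag.filter fun p => p.1 % b = p.2 % b).card + q := by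
    rw [← Finset.diag_union_offDiag, Finset.filter_union, Finset.card_union_of_disjoint
      (Finset.disjoint_filter_filter (Finset.disjoint_diag_offDiag _)), add_comm]
    congr 1
    rw [Finset.filter_true_of_mem, Finset.diag_card, Finset.card_range]
    intro p hp
    rw [(Finset.mem_diag.1 hp).2]
  have hall : (((Finset.range q) ×ˢ (Finset.range q)).filter fun p => p.1 % b = p.2 % b).card =
      q * (q / b) + q % b * (q / b + 1) := by
    rw [Finset.card_filter, Finset.sum_product]
    calc ∑ y ∈ Finset.range q, ∑ z ∈ Finset.range q, (if y % b = z % b then 1 else 0)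
        = ∑ y ∈ Finset.range q, (q / b + if y % b < q % b then 1 else 0) := by
          refine Finset.sum_congr rfl fun y _ => ?_
          rw [← card_filter_range_mod_eq hb q y, Finset.card_filter]
          simp only [eq_comm]
      _ = _ := by
          rw [Finset.sum_add_distrib, Finset.sum_const, Finset.card_range, smul_eq_mul,
            ← Finset.card_filter, card_filter_range_mod_lt hb]
  have h : (((Finset.range q).offDiag.filter fun p => p.1 % b = p.2 % b).card : ℝ) + q =
      q * (q / b : ℕ) + (q % b : ℕ) * ((q / b : ℕ) + 1) := by
    exact_mod_cast hsplit.symm.trans hall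
  have hq : (b : ℝ) * (q / b : ℕ) + (q % b : ℕ) = q := by exact_mod_cast Nat.div_add_mod q b
  -- After subtracting the diagonal, the leftover `q % b - q` is `-b * (q / b)`.
  linear_combination h + hq

namespace FE1

variable {n : ℕ} (P : FE1 n)

theorem card_seeds : P.seeds.card = (P.q - 1) * P.q := by
  simp [seeds]

/-- An affine map over the field `ZMod q` is determined by its values at two distinct points;
elements of `[B]` stay distinct modulo `q` because `B ≤ q`. -/
theorem injOn_evaluate {x x' : ℕ} (hx : x ∈ Finset.Icc 1 P.B) (hx' : x' ∈ Finset.Icc 1 P.B)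
    (hne : x ≠ x') :
    Set.InjOn (fun s : ℕ × ℕ => ((s.1 * x + s.2) % P.q, (s.1 * x' + s.2) % P.q)) P.seeds := by
  have : Fact P.q.Prime := ⟨P.q_prime⟩
  have cast_inj : ∀ {y z : ℕ}, y ∈ Finset.Icc 1 P.q → z ∈ Finset.Icc 1 P.q →
      (y : ZMod P.q) = z → y = z := by
    intro y z hy hz h
    rw [Finset.mem_Icc] at hy hz
    have h' := (ZMod.natCast_eq_natCast_iff y z P.q).1 h
    exact Nat.ModEq.eq_of_abs_lt h' (by rw [abs_lt]; omega)
  have hle : Finset.Icc 1 P.B ⊆ Finset.Icc 1 P.q := Finset.Icc_subset_Icc_right P.B_le_q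
  have hd : ((x : ZMod P.q) - x') ≠ 0 := fun h =>
    hne (cast_inj (hle hx) (hle hx') (sub_eq_zero.1 h))
  rintro ⟨u, v⟩ h1 ⟨u', v'⟩ h2 h
  simp only [seeds, Finset.coe_product, Set.mem_prod, Finset.mem_coe] at h1 h2
  have e1 := (ZMod.natCast_eq_natCast_iff _ _ P.q).2 (Prod.ext_iff.1 h).1
  have e2 := (ZMod.natCast_eq_natCast_iff _ _ P.q).2 (Prod.ext_iff.1 h).2
  push_cast at e1 e2
  have hu : (u : ZMod P.q) = u' := by
    refine mul_right_cancel₀ hd ?_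
    linear_combination e1 - e2
  have hv : (v : ZMod P.q) = v' := by
    rw [hu] at e1
    exact add_left_cancel e1
  have hsub : Finset.Icc 1 (P.q - 1) ⊆ Finset.Icc 1 P.q :=
    Finset.Icc_subset_Icc_right (Nat.sub_le _ _)
  rw [cast_inj (hsub h1.1) (hsub h2.1) hu, cast_inj h1.2 h2.2 hv]

/-- A slope `u` prime to `q` separates `x` from `x'`, which gives one inclusion; both sides have
`(q-1) q` elements. -/
theorem image_evaluate {x x' : ℕ} (hx : x ∈ Finset.Icc 1 P.B) (hx' : x' ∈ Finset.Icc 1 P.B)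
    (hne : x ≠ x') :
    P.seeds.image (fun s : ℕ × ℕ => ((s.1 * x + s.2) % P.q, (s.1 * x' + s.2) % P.q)) =
      (Finset.range P.q).offDiag := by
  have : Fact P.q.Prime := ⟨P.q_prime⟩
  have hq := P.q_prime.pos
  refine Finset.eq_of_subset_of_card_le ?_ ?_
  · intro p hp
    obtain ⟨⟨u, v⟩, hs, rfl⟩ := Finset.mem_image.1 hp
    simp only [seeds, Finset.mem_product, Finset.mem_Icc] at hs
    simp only [Finset.mem_offDiag, Finset.mem_range]
    refine ⟨Nat.mod_lt _ hq, Nat.mod_lt _ hq, fun h => ?_⟩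
    have h1 : u * x ≡ u * x' [MOD P.q] := Nat.ModEq.add_right_cancel' v h
    have hcop : Nat.gcd P.q u = 1 := by
      refine (Nat.Prime.coprime_iff_not_dvd P.q_prime).2 fun hdvd => ?_
      have := Nat.le_of_dvd (by omega) hdvd
      omega
    have h2 : x ≡ x' [MOD P.q] := Nat.ModEq.cancel_left_of_coprime hcop h1
    rw [Finset.mem_Icc] at hx hx'
    have := P.B_le_q
    exact hne (Nat.ModEq.eq_of_abs_lt h2 (by rw [abs_lt]; omega))
  · rw [Finset.card_image_of_injOn (P.injOn_evaluate hx hx' hne), card_seeds, Finset.offDiag_card,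
      Finset.card_range, Nat.sub_mul, one_mul]

theorem card_filter_collision {x x' : ℕ} (hx : x ∈ Finset.Icc 1 P.B)
    (hx' : x' ∈ Finset.Icc 1 P.B) (hne : x ≠ x') :
    ((P.seeds.filter fun s => P.hash s.1 s.2 x = P.hash s.1 s.2 x').card : ℝ) =
      P.pcol * P.seeds.card := by
  have hq : (2 : ℝ) ≤ P.q := by exact_mod_cast P.q_prime.two_le
  have hcard : (P.seeds.card : ℝ) = P.q * (P.q - 1) := by
    rw [card_seeds, Nat.cast_mul, Nat.cast_sub P.q_prime.one_le, Nat.cast_one, mul_comm]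
  rw [hcard, pcol, div_mul_cancel₀ _ (by nlinarith), ← card_offDiag_range_mod_eq P.b_pos,
    ← P.image_evaluate hx hx' hne, Finset.filter_image, Finset.card_image_of_injOn]
  · rfl
  · exact (P.injOn_evaluate hx hx' hne).mono (Finset.coe_subset.2 (Finset.filter_subset _ _))

theorem pcol_nonneg : 0 ≤ P.pcol := by
  have hq : (2 : ℝ) ≤ P.q := by exact_mod_cast P.q_prime.two_le
  rw [pcol, ← card_offDiag_range_mod_eq P.b_pos]
  exact div_nonneg (Nat.cast_nonneg _) (by nlinarith)

/-- From `q % b ≤ b - 1` the bracket is at most `q - 1`, and `⌊q/b⌋ * b ≤ q`. -/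
theorem pcol_le : P.pcol ≤ 1 / P.b := by
  have hq : (2 : ℝ) ≤ P.q := by exact_mod_cast P.q_prime.two_le
  have hb : (0 : ℝ) < P.b := Nat.cast_pos.2 P.b_pos
  have h1 : ((P.q % P.b : ℕ) : ℝ) + 1 ≤ P.b := by exact_mod_cast Nat.mod_lt P.q P.b_pos
  have h2 : ((P.q / P.b : ℕ) : ℝ) * P.b ≤ P.q := by exact_mod_cast Nat.div_mul_le_self P.q P.b
  have h3 : (0 : ℝ) ≤ (P.q / P.b : ℕ) := Nat.cast_nonneg _
  rw [pcol, div_le_div_iff₀ (by nlinarith) hb]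
  have h4 := mul_le_mul_of_nonneg_left (a := ((P.q / P.b : ℕ) : ℝ) * P.b)
    (by linarith : ((P.q % P.b : ℕ) : ℝ) + P.q - P.b ≤ P.q - 1) (by positivity)
  have h5 := mul_le_mul_of_nonneg_right h2 (by linarith : (0 : ℝ) ≤ P.q - 1)
  linarith

theorem pcol_le_half : P.pcol ≤ 1 / 2 := by
  have hb : (2 : ℝ) ≤ P.b := by exact_mod_cast P.two_le_b
  exact P.pcol_le.trans (one_div_le_one_div_of_le two_pos hb)

/-! ### Exponential moments of the counts of the analyzer -/

theorem lexp_sample_expCount_self (x : ℕ) (t : ℝ) :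
    lexp (P.sample x) (expCount (P.Supports x) t) = ENNReal.ofReal (Real.exp t) := by
  rw [lexp_sample]
  refine (congrArg (lexp P.seed) (funext fun s => ?_)).trans (lexp_const P.seed _)
  rw [expCount_singleton, if_pos (show P.Supports x (s.1, s.2, P.hash s.1 s.2 x) from rfl)]

theorem lexp_sample_expCount_of_ne {x y : ℕ} (hx : x ∈ Finset.Icc 1 P.B)
    (hy : y ∈ Finset.Icc 1 P.B) (hne : x ≠ y) (t : ℝ) :
    lexp (P.sample y) (expCount (P.Supports x) t) ≤
      ENNReal.ofReal (Real.exp (P.pcol * (Real.exp t - 1))) := by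
  have hc : (0 : ℝ) < P.seeds.card := Nat.cast_pos.2 P.seeds_nonempty.card_pos
  rw [lexp_sample, seed, lexp_uniformOfFinset]
  simp only [expCount_singleton]
  rw [← ENNReal.ofReal_sum_of_nonneg fun s _ => by split_ifs <;> positivity,
    ← ENNReal.ofReal_natCast, ← ENNReal.ofReal_inv_of_pos hc,
    ← ENNReal.ofReal_mul (by positivity)]
  refine ENNReal.ofReal_le_ofReal ?_
  have hsum : ∑ s ∈ P.seeds, (if P.Supports x (s.1, s.2, P.hash s.1 s.2 y) then Real.exp t else 1)
      = P.seeds.card * (1 + P.pcol * (Real.exp t - 1)) := by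
    calc _ = ∑ s ∈ P.seeds, (1 + (if P.hash s.1 s.2 x = P.hash s.1 s.2 y then 1 else 0) *
          (Real.exp t - 1)) := by
          refine Finset.sum_congr rfl fun s _ => ?_
          by_cases h : P.hash s.1 s.2 x = P.hash s.1 s.2 y
          · rw [if_pos h, if_pos (show P.Supports x (s.1, s.2, P.hash s.1 s.2 y) from h)]
            ring
          · rw [if_neg h, if_neg (show ¬ P.Supports x (s.1, s.2, P.hash s.1 s.2 y) from h)]
            ring
      _ = _ := by
          rw [Finset.sum_add_distrib, ← Finset.sum_mul, Finset.sum_boole,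
            P.card_filter_collision hx hy hne, Finset.sum_const, nsmul_eq_mul]
          ring
  rw [hsum, inv_mul_cancel_left₀ hc.ne']
  linarith [Real.add_one_le_exp (P.pcol * (Real.exp t - 1))]

/-- The expected number of messages that support `x`. -/
noncomputable def countMean (D : Fin n → Dom P.B) (x : Dom P.B) : ℝ :=
  freq D x + ((n : ℝ) - freq D x) * P.pcol + P.noiseMean

theorem freq_le {B : ℕ} (D : Fin n → Dom B) (x : Dom B) : freq D x ≤ n := by
  simpa [freq] using Finset.card_filter_le (Finset.univ : Finset (Fin n)) fun i => D i = x

/-- Holders of `x` contribute exactly `exp t`, hence no variance. The other users and the noise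
contribute at most `exp (m (exp t - 1))` with `m` their mean, and `exp t - 1 - t ≤ t²` for `|t| ≤
1`. -/
theorem lexp_view_expCount_le (D : Fin n → Dom P.B) (x : Dom P.B) {t : ℝ} (ht : |t| ≤ 1) :
    lexp (P.view D) (expCount (P.Supports x) t) ≤
      ENNReal.ofReal (Real.exp (t * P.countMean D x +
        ((n : ℝ) / P.b + P.noiseMean) * t ^ 2)) := by
  have hsample : ∀ i, lexp (P.sample (D i)) (expCount (P.Supports x) t) ≤
      ENNReal.ofReal (Real.exp (P.pcol * (Real.exp t - 1) +
        (if D i = x then 1 else 0) * (t - P.pcol * (Real.exp t - 1)))) := by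
    intro i
    by_cases h : D i = x
    · rw [if_pos h, h, lexp_sample_expCount_self]
      exact le_of_eq (by ring_nf)
    · rw [if_neg h, zero_mul, add_zero]
      exact P.lexp_sample_expCount_of_ne x.2 (D i).2 (fun e => h (Subtype.ext e.symm)) t
  rw [view_eq, lexp_convolve_mul (expCount_add _ t),
    lexp_shuffleView (expCount_zero _ t) (expCount_add _ t)]
  refine (mul_le_mul' (Finset.prod_le_prod' fun i _ => hsample i)
    (P.lexp_convolvePow_noise_expCount_le x t)).trans ?_
  rw [← ENNReal.ofReal_prod_of_nonneg fun i _ => (Real.exp_pos _).le, ← Real.exp_sum,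
    ← ENNReal.ofReal_mul (Real.exp_pos _).le, ← Real.exp_add]
  refine ENNReal.ofReal_le_ofReal (Real.exp_le_exp.2 ?_)
  rw [Finset.sum_add_distrib, Finset.sum_const, ← Finset.sum_mul, Finset.sum_boole,
    Finset.card_univ, Fintype.card_fin, nsmul_eq_mul]
  change _ + (freq D x : ℝ) * _ + _ ≤ _
  have he : Real.exp t - 1 - t ≤ t ^ 2 := (abs_le.1 (Real.abs_exp_sub_one_sub_id_le ht)).2
  have he0 : 0 ≤ Real.exp t - 1 - t := by linarith [Real.add_one_le_exp t]
  have hf : (freq D x : ℝ) ≤ n := by exact_mod_cast freq_le D x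
  have hvar : ((n : ℝ) - freq D x) * P.pcol + P.noiseMean ≤ (n : ℝ) / P.b + P.noiseMean := by
    have h1 : ((n : ℝ) - freq D x) * P.pcol ≤ n * (1 / P.b) :=
      mul_le_mul (by linarith [(Nat.cast_nonneg (freq D x) : (0 : ℝ) ≤ _)]) P.pcol_le
        P.pcol_nonneg (Nat.cast_nonneg n)
    rw [mul_one_div] at h1
    linarith
  have hvar0 : 0 ≤ ((n : ℝ) - freq D x) * P.pcol + P.noiseMean :=
    add_nonneg (mul_nonneg (by linarith) P.pcol_nonneg) P.noiseMean_nonneg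
  have key := mul_le_mul hvar he he0 (hvar0.trans hvar)
  rw [countMean]
  linarith

theorem count_upper_tail (D : Fin n → Dom P.B) (x : Dom P.B) {t : ℝ} (ht0 : 0 ≤ t) (ht : t ≤ 1)
    (a : ℝ) :
    (P.view D).toOuterMeasure {T | a ≤ (T.countP (P.Supports x) : ℕ) - P.countMean D x} ≤
      ENNReal.ofReal (Real.exp (((n : ℝ) / P.b + P.noiseMean) * t ^ 2 - t * a)) := by
  refine (toOuterMeasure_le_exp_mul_lexp (P.Supports x) _ t (P.countMean D x + a) _ fun T hT =>
    mul_le_mul_of_nonneg_left (by linarith [show a ≤ _ from hT]) ht0).trans ?_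
  refine (mul_le_mul_right (P.lexp_view_expCount_le D x (by rwa [abs_of_nonneg ht0])) _).trans ?_
  rw [← ENNReal.ofReal_mul (Real.exp_pos _).le, ← Real.exp_add]
  exact le_of_eq (by ring_nf)

theorem count_lower_tail (D : Fin n → Dom P.B) (x : Dom P.B) {t : ℝ} (ht0 : 0 ≤ t) (ht : t ≤ 1)
    (a : ℝ) :
    (P.view D).toOuterMeasure {T | a ≤ P.countMean D x - (T.countP (P.Supports x) : ℕ)} ≤
      ENNReal.ofReal (Real.exp (((n : ℝ) / P.b + P.noiseMean) * t ^ 2 - t * a)) := by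
  refine (toOuterMeasure_le_exp_mul_lexp (P.Supports x) _ (-t) (P.countMean D x - a) _ fun T hT =>
    mul_le_mul_of_nonpos_left (by linarith [show a ≤ _ from hT]) (by linarith)).trans ?_
  refine (mul_le_mul_right (P.lexp_view_expCount_le D x
    (by rwa [abs_neg, abs_of_nonneg ht0])) _).trans ?_
  rw [← ENNReal.ofReal_mul (Real.exp_pos _).le, ← Real.exp_add]
  exact le_of_eq (by ring_nf)

/-- Unbiasedness: the correction of the analyzer inverts the affine dependence of `countMean` on the
frequency. -/
theorem analyzer_sub_freq (D : Fin n → Dom P.B) (x : Dom P.B) (T : Multiset Message) :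
    P.analyzer T x - freq D x =
      ((T.countP (P.Supports x) : ℕ) - P.countMean D x) / (1 - P.pcol) := by
  have h : 1 - P.pcol ≠ 0 := by linarith [P.pcol_le_half]
  have hT : (T.countP fun m => P.hash m.1 m.2.1 x = m.2.2) = T.countP (P.Supports x) := rfl
  rw [analyzer, hT, countMean, noiseMean, eq_div_iff h, sub_mul, div_mul_cancel₀ _ h]
  ring

/-- The estimates of all elements are accurate, in terms of the parameter `t` of the exponential
moments. -/
theorem isAccurate_protocol {t α β : ℝ} (ht0 : 0 ≤ t) (ht : t ≤ 1) (hβ : 0 < β)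
    (H : 2 * P.B * Real.exp (((n : ℝ) / P.b + P.noiseMean) * t ^ 2 - t * (α / 2)) < β) :
    IsAccurate P.protocol α β := by
  classical
  intro D
  rw [protocol, PMF.toOuterMeasure_map_apply]
  set e : ℝ := Real.exp (((n : ℝ) / P.b + P.noiseMean) * t ^ 2 - t * (α / 2)) with he
  have hsub : P.analyzer ⁻¹' {g | ∃ j, α < |g j - (freq D j : ℝ)|} ⊆
      ⋃ j ∈ (Finset.univ : Finset (Dom P.B)),
        ({T | α / 2 ≤ (T.countP (P.Supports j) : ℕ) - P.countMean D j} ∪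
          {T | α / 2 ≤ P.countMean D j - (T.countP (P.Supports j) : ℕ)}) := by
    rintro T ⟨j, hj⟩
    simp only [Set.mem_iUnion]
    refine ⟨j, Finset.mem_univ j, ?_⟩
    have hp := P.pcol_le_half
    have hp0 : 0 < 1 - P.pcol := by linarith
    rw [analyzer_sub_freq, abs_div, abs_of_pos hp0, lt_div_iff₀ hp0] at hj
    have habs := abs_nonneg ((T.countP (P.Supports j) : ℝ) - P.countMean D j)
    -- Since `1 - pcol ≥ 1/2`, an error above `α` forces a deviation of at least `α/2`; for negative
    -- `α` this is trivial.
    have h2 : α / 2 ≤ |(T.countP (P.Supports j) : ℝ) - P.countMean D j| := by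
      by_cases hα : 0 ≤ α
      · nlinarith
      · linarith
    rcases le_abs.1 h2 with h | h
    · exact Or.inl h
    · exact Or.inr (show α / 2 ≤ _ by linarith)
  calc _ ≤ ∑ j : Dom P.B, (ENNReal.ofReal e + ENNReal.ofReal e) := by
        refine (MeasureTheory.measure_mono hsub).trans
          ((MeasureTheory.measure_biUnion_finset_le _ _).trans
          (Finset.sum_le_sum fun j _ => (MeasureTheory.measure_union_le _ _).trans ?_))
        exact add_le_add (P.count_upper_tail D j ht0 ht _) (P.count_lower_tail D j ht0 ht _)
    _ = ENNReal.ofReal (2 * P.B * e) := by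
        rw [Finset.sum_const, Finset.card_univ, Fintype.card_coe, Nat.card_Icc, nsmul_eq_mul,
          ← ENNReal.ofReal_add (Real.exp_pos _).le (Real.exp_pos _).le, ← ENNReal.ofReal_natCast,
          ← ENNReal.ofReal_mul (Nat.cast_nonneg _), Nat.add_sub_cancel]
        congr 1
        ring
    _ < ENNReal.ofReal β := (ENNReal.ofReal_lt_ofReal_iff hβ).2 H

end FE1

/-! ### Asymptotics -/

namespace FE1

variable {n : ℕ} (P : FE1 n)

theorem log_one_div_delta_pos : 0 < Real.log (1 / P.δ) :=
  Real.log_pos (by rw [lt_div_iff₀ P.δ_pos, one_mul]; exact P.δ_lt)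

theorem log_two_div_delta : Real.log (2 / P.δ) = Real.log 2 + Real.log (1 / P.δ) := by
  rw [← Real.log_mul two_ne_zero (one_div_ne_zero P.δ_pos.ne'), mul_one_div]

/-- As `b ≥ 2`, rounding by less than `1` changes the value by at most a factor `2`; the same holds
in the other direction. -/
theorem b_le_two_mul {y : ℝ} (h : |(P.b : ℝ) - y| < 1) : (P.b : ℝ) ≤ 2 * y := by
  have hb : (2 : ℝ) ≤ P.b := by exact_mod_cast P.two_le_b
  linarith [(abs_lt.1 h).2]

theorem le_two_mul_b {y : ℝ} (h : |(P.b : ℝ) - y| < 1) : y ≤ 2 * P.b := by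
  have hb : (2 : ℝ) ≤ P.b := by exact_mod_cast P.two_le_b
  linarith [(abs_lt.1 h).1]

theorem rho_le {φ l : ℝ} (hn : n ≠ 0) (hl : 0 < l) (hδ : l ≤ Real.log (1 / P.δ))
    (hb : |(P.b : ℝ) - φ * P.scale| < 1) : P.rho ≤ 64 * (1 + 1 / l) * φ := by
  have hL := P.log_one_div_delta_pos
  have hn' : (0 : ℝ) < n := Nat.cast_pos.2 (Nat.pos_of_ne_zero hn)
  have hε := P.ε_pos
  have hbpos : (0 : ℝ) < P.b := Nat.cast_pos.2 P.b_pos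
  have h1 := P.b_le_two_mul hb
  have hlog : Real.log (2 / P.δ) ≤ (1 + 1 / l) * Real.log (1 / P.δ) := by
    have h2 : 1 ≤ 1 / l * Real.log (1 / P.δ) := by
      rw [one_div_mul_eq_div, le_div_iff₀ hl, one_mul]
      exact hδ
    rw [log_two_div_delta]
    linarith [Real.log_two_lt_d9]
  have hscale : P.scale * Real.log (1 / P.δ) = P.ε ^ 2 * n := div_mul_cancel₀ _ hL.ne'
  have hc : 0 < 1 + 1 / l := by positivity
  rw [rho, div_mul_div_comm, div_le_iff₀ (by positivity)]
  calc 32 * Real.log (2 / P.δ) * P.b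
      ≤ 32 * ((1 + 1 / l) * Real.log (1 / P.δ)) * P.b := by gcongr
    _ ≤ 32 * ((1 + 1 / l) * Real.log (1 / P.δ)) * (2 * (φ * P.scale)) := by gcongr
    _ = 64 * (1 + 1 / l) * φ * (P.scale * Real.log (1 / P.δ)) := by ring
    _ = 64 * (1 + 1 / l) * φ * (P.ε ^ 2 * n) := by rw [hscale]

/-- The variance proxy of the counts is polylogarithmic up to a factor `ε⁻²`. -/
theorem variance_le {φ c S : ℝ} (hn : n ≠ 0) (hc : 0 < c) (hlog : 0 < Real.log n)
    (hφ : Real.log n ^ (-c) ≤ φ) (hb : |(P.b : ℝ) - φ * P.scale| < 1) (hS : 1 ≤ S)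
    (hSn : Real.log n ≤ S) (hSδ : Real.log (1 / P.δ) ≤ S) :
    ((n : ℝ) / P.b + P.noiseMean) * P.ε ^ 2 ≤ 66 * (S ^ (⌈c⌉₊ + 1)) ^ 2 := by
  have hL := P.log_one_div_delta_pos
  have hbpos : (0 : ℝ) < P.b := Nat.cast_pos.2 P.b_pos
  have hS0 : 0 < S := by linarith
  have hpow : 0 < Real.log n ^ (-c) := Real.rpow_pos_of_pos hlog _
  have hφ0 : 0 < φ := hpow.trans_le hφ
  have hscale : P.scale * Real.log (1 / P.δ) = P.ε ^ 2 * n := div_mul_cancel₀ _ hL.ne'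
  -- The odd exponent becomes even with the further factor `log (1/δ) ≤ S`, so the variance bound is
  -- a perfect square, suited to the choice of `t`.
  have hinv : 1 / φ ≤ S ^ (2 * ⌈c⌉₊ + 1) := by
    calc 1 / φ ≤ 1 / Real.log n ^ (-c) := one_div_le_one_div_of_le hpow hφ
      _ = Real.log n ^ c := by rw [Real.rpow_neg hlog.le, one_div, inv_inv]
      _ ≤ S ^ c := Real.rpow_le_rpow hlog.le hSn hc.le
      _ ≤ S ^ ((2 * ⌈c⌉₊ + 1 : ℕ) : ℝ) := by
          refine Real.rpow_le_rpow_of_exponent_le hS ?_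
          push_cast
          linarith [Nat.le_ceil c]
      _ = S ^ (2 * ⌈c⌉₊ + 1) := Real.rpow_natCast _ _
  have h1 : (n : ℝ) / P.b * P.ε ^ 2 ≤ 2 * (S ^ (⌈c⌉₊ + 1)) ^ 2 := by
    have h2 : P.ε ^ 2 * n ≤ 2 * P.b * Real.log (1 / P.δ) * (1 / φ) := by
      rw [mul_one_div, le_div_iff₀ hφ0, ← hscale]
      linarith [mul_le_mul_of_nonneg_right (P.le_two_mul_b hb) hL.le]
    rw [div_mul_eq_mul_div, div_le_iff₀ hbpos]
    calc (n : ℝ) * P.ε ^ 2 ≤ 2 * P.b * (Real.log (1 / P.δ) * (1 / φ)) := by linarith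
      _ ≤ 2 * P.b * (S * S ^ (2 * ⌈c⌉₊ + 1)) := by gcongr
      _ = 2 * (S ^ (⌈c⌉₊ + 1)) ^ 2 * P.b := by ring
  have h4 : P.noiseMean * P.ε ^ 2 ≤ 64 * (S ^ (⌈c⌉₊ + 1)) ^ 2 := by
    rw [P.noiseMean_mul_sq hn, log_two_div_delta]
    have h5 : S ≤ (S ^ (⌈c⌉₊ + 1)) ^ 2 := by
      rw [← pow_mul]
      exact le_self_pow₀ hS (by positivity)
    linarith [Real.log_two_lt_d9]
  linarith

theorem isAccurate_protocol_of_log_le {φ c β : ℝ} (hc : 0 < c) (hlog : 1 ≤ Real.log n)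
    (hφ : Real.log n ^ (-c) ≤ φ) (hb : |(P.b : ℝ) - φ * P.scale| < 1) (hβ : 0 < β)
    (hβ1 : β ≤ 1) :
    IsAccurate P.protocol (72 / P.ε *
      (Real.log n + Real.log P.B + Real.log (1 / P.δ) + Real.log (1 / β)) ^ (⌈c⌉₊ + 2)) β := by
  -- `Real.log 0 = 0` contradicts `1 ≤ log n`.
  have hn : n ≠ 0 := by
    rintro rfl
    simp only [Nat.cast_zero, Real.log_zero] at hlog
    linarith
  have hB : 1 ≤ P.B := by
    have := P.q_lt
    omega
  have hB' : (0 : ℝ) < P.B := Nat.cast_pos.2 hB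
  have hlogB : 0 ≤ Real.log P.B := Real.log_natCast_nonneg _
  have hL := P.log_one_div_delta_pos
  have hlogβ : 0 ≤ Real.log (1 / β) := Real.log_nonneg (by rwa [le_div_iff₀ hβ, one_mul])
  have hε := P.ε_pos
  set S := Real.log n + Real.log P.B + Real.log (1 / P.δ) + Real.log (1 / β) with hS
  have hS1 : 1 ≤ S := by linarith
  have hvar := P.variance_le hn hc (by linarith) hφ hb hS1 (by linarith) (by linarith)
  set m := ⌈c⌉₊ + 1 with hm
  have hSm : 1 ≤ S ^ m := one_le_pow₀ hS1
  have hSm0 : 0 < S ^ m := by linarith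
  -- Here `t ≤ 1` because `ε ≤ 3` and `S ≥ 1`. The quadratic term is at most `66/9 ≤ 8`, and `72`
  -- makes the linear term `12 S`. As `S ≥ 1` and `S ≥ log B + log (1/β)`, the exponent is at most
  -- `-3 + log (β/B)`, and `2 exp (-3) < 1` pays for the two tails.
  refine P.isAccurate_protocol (t := P.ε / (3 * S ^ m)) (by positivity) ?_ hβ ?_
  · rw [div_le_one (by positivity)]
    linarith [P.ε_le]
  have e1 : P.ε / (3 * S ^ m) * (72 / P.ε * S ^ (⌈c⌉₊ + 2) / 2) = 12 * S := by
    rw [hm]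
    field_simp
    ring
  have e2 : ((n : ℝ) / P.b + P.noiseMean) * (P.ε / (3 * S ^ m)) ^ 2 ≤ 8 := by
    rw [div_pow, ← mul_div_assoc, div_le_iff₀ (by positivity)]
    nlinarith [sq_nonneg (S ^ m)]
  have e3 : Real.exp (((n : ℝ) / P.b + P.noiseMean) * (P.ε / (3 * S ^ m)) ^ 2 -
      P.ε / (3 * S ^ m) * (72 / P.ε * S ^ (⌈c⌉₊ + 2) / 2)) ≤
      Real.exp (-3) * (β / P.B) := by
    rw [e1, ← Real.exp_log (div_pos hβ hB'), ← Real.exp_add]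
    refine Real.exp_le_exp.2 ?_
    rw [Real.log_div hβ.ne' hB'.ne']
    rw [one_div β, Real.log_inv] at hS hlogβ
    linarith
  have e4 : 2 * Real.exp (-3) < 1 := by
    have h := Real.add_one_le_exp (3 : ℝ)
    rw [Real.exp_neg, ← div_eq_mul_inv, div_lt_one (Real.exp_pos _)]
    linarith
  calc _ ≤ 2 * P.B * (Real.exp (-3) * (β / P.B)) := by gcongr
    _ = 2 * Real.exp (-3) * β := by field_simp
    _ < 1 * β := by gcongr
    _ = β := one_mul β

end FE1

theorem mainTheorem5 (P : (n : ℕ) → FE1 n) (f : ℕ → ℝ)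
    -- `δ` stays away from `1` (in particular this holds if `δ < n ^ (-Ω(1))`)
    (hδ : ∃ δ₀ : ℝ, δ₀ < 1 ∧ ∀ᶠ n in atTop, (P n).δ ≤ δ₀)
    -- `B = Ω(ε² n / log (1/δ))`
    (hB : (fun n => (P n).scale) =O[atTop] fun n => ((P n).B : ℝ))
    -- `(log n) ^ (-Ω(1)) ≤ f n`
    (hf_lower : ∃ c : ℝ, 0 < c ∧ ∀ᶠ n : ℕ in atTop, Real.log n ^ (-c) ≤ f n)
    -- `f n = o(1)`
    (hf_upper : f =o[atTop] fun _ => (1 : ℝ))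
    -- `b = f n * ε² n / log (1/δ)`, rounded to an integer in either direction
    (hb : ∀ᶠ n in atTop, |((P n).b : ℝ) - f n * (P n).scale| < 1) :
    -- the protocol is shuffle differentially private
    (∀ n, IsDifferentiallyPrivate (P n).view (P n).ε (P n).δ) ∧
    -- each user sends `1 + o(1)` messages in expectation
    (∃ r : ℕ → ℝ, r =o[atTop] (fun _ => (1 : ℝ)) ∧
      ∀ᶠ n in atTop, ∀ x : Dom (P n).B,
        expectedCard ((P n).randomizer x) = ENNReal.ofReal (1 + r n)) ∧
    -- the error is `Õ(1)`
    (∃ C : ℝ, ∃ k : ℕ, ∀ᶠ n : ℕ in atTop, ∀ β : ℝ, 0 < β → β ≤ 1 →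
      IsAccurate (P n).protocol
        (C / (P n).ε *
          (Real.log n + Real.log (P n).B + Real.log (1 / (P n).δ) + Real.log (1 / β)) ^ k) β) := by
  have hn : ∀ᶠ n : ℕ in atTop, 1 ≤ Real.log n :=
    (Real.tendsto_log_atTop.comp tendsto_natCast_atTop_atTop).eventually_ge_atTop 1
  refine ⟨fun n => (P n).isDifferentiallyPrivate_view, ⟨fun n => (P n).rho, ?_,
    Eventually.of_forall fun n x => (P n).expectedCard_randomizer x⟩, ?_⟩
  · obtain ⟨δ₀, hδ₀, hδ⟩ := hδ
    have hδ₀' : 0 < δ₀ := by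
      obtain ⟨n, h⟩ := hδ.exists
      exact (P n).δ_pos.trans_le h
    have hl : 0 < Real.log (1 / δ₀) := Real.log_pos (by rwa [lt_div_iff₀ hδ₀', one_mul])
    refine IsBigO.trans_isLittleO (IsBigO.of_bound (64 * (1 + 1 / Real.log (1 / δ₀))) ?_) hf_upper
    filter_upwards [hδ, hb, eventually_ne_atTop 0] with n h1 h2 h3
    rw [Real.norm_of_nonneg (P n).rho_nonneg]
    refine ((P n).rho_le h3 hl (Real.log_le_log (by positivity)
      (one_div_le_one_div_of_le (P n).δ_pos h1)) h2).trans ?_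
    gcongr
    exact Real.le_norm_self _
  · obtain ⟨c, hc, hf⟩ := hf_lower
    refine ⟨72, ⌈c⌉₊ + 2, ?_⟩
    filter_upwards [hn, hf, hb] with n h1 h2 h3 β hβ hβ1
    exact (P n).isAccurate_protocol_of_log_le hc h1 h2 h3 hβ hβ1
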